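/- Let $d\ge 1$, $n\ge 0$, let $U\in U(d)$ and let $|e\rangle=|e_1,\dots,e_n\rangle$ be a standard basis vector of $(\mathbb C^d)^{\otimes n}$. For $\pi\in S_n$ let $P_\pi$ be the operator permuting the tensor factors. For a partition $\lambda=(\lambda_1\ge\dots\ge\lambda_k>0)$ of $n$ with $k\le d$ parts, number the boxes of its Young diagram from left to right and then from top to bottom, let $A_\lambda,B_\lambda\subseteq S_n$ be the groups of permutations preserving the rows, respectively the columns, and put $Y_\lambda=\sum_{a\in A_\lambda}P_a\sum_{b\in B_\lambda}\mathrm{sgn}(b)P_b$, $\mathcal Q_\lambda=Y_\lambda(\mathbb C^d)^{\otimes n}$ and $\Pi^{(\lambda)}_{\rm sym}=\frac1{|A_\lambda|}\sum_{\pi\in A_\lambda}P_\pi$. For $w\in\mathbb N^d$ let $V(w)$ be the span of the standard basis vectors in which each symbol $i$ occurs exactly $w_i$ times. Nice Schur basis. For each $\lambda$, let $|(\lambda,0,0)\rangle,|(\lambda,1,0)\rangle,\dots$ be the concatenation of arbitrary orthonormal bases of the spaces $Y_\lambda V(w)$, with $w$ in reverse lexicographic order; extend $|(\lambda,0,0)\rangle$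 to an orthonormal basis $(|(\lambda,0,j)\rangle)_j$ of $\mathrm{span}\{P_\pi|(\lambda,0,0)\rangle:\pi\in S_n\}$; write $|(\lambda,0,j)\rangle=\sum_\pi\alpha^{(\lambda,j)}_\pi P_\pi|(\lambda,0,0)\rangle$ and set $|(\lambda,i,j)\rangle=\sum_\pi\alpha^{(\lambda,j)}_\pi P_\pi|(\lambda,i,0)\rangle$. Pre-processing. On input $U^{\otimes n}|e\rangle$, measure with the orthogonal projections $\Pi_{\lambda,j}$ onto $\mathrm{span}\{|(\lambda,i,j)\rangle: i\}$; on outcome $(\lambda,j)$ (of positive probability) apply the change of basis $H_{\lambda,j}$ that swaps $|(\lambda,i,0)\rangle$ and $|(\lambda,i,j)\rangle$ for all $i$ and fixes the other basis vectors; return $\lambda$ and the normalized state $H_{\lambda,j}\Pi_{\lambda,j}U^{\otimes n}|e\rangle$. Row symmetric measurement. Let $\mu_H$ be the distribution of $V|0\rangle\langle 0|V^\dagger$, where $|0\rangle$ is a fixed standard basis vector of $\mathbb C^d$ and $V\in U(d)$ is Haar random, and let $\kappa_s=\binom{s+d-1}{d-1}$. The measurement $\mathcal M^{(\lambda)}$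 is the POVM with elements $F^{(\lambda)}(\psi_1,\dots,\psi_k)=\bigotimes_{i=1}^k\kappa_{\lambda_i}\psi_i^{\otimes\lambda_i}$ with respect to $\mu_H^k$ (the factor $\psi_i^{\otimes \lambda_i}$ acting on the $i$-th row), together with a "fail" element $I-\Pi^{(\lambda)}_{\rm sym}$. On the outcome $(\psi_1,\dots,\psi_k)$ put $\Psi=\sum_{i=1}^k(d+\lambda_i)\psi_i$. Lemma. Suppose that the pre-processing on input $U^{\otimes n}|e\rangle$ outputs a partition $\lambda$ with exactly $k$ parts and the state $U^{\otimes n}|\tau\rangle$, and that $|\tau\rangle\in V(w)$. Then, when $\mathcal M^{(\lambda)}$ is performed on $U^{\otimes n}|\tau\rangle$, the Born rule defines a probability distribution of the outcome, "fail" has probability $0$, $\Psi$ is integrable, and $$\mathbb E[\Psi]=kI+\sum_{i=1}^d w_i\,U|i\rangle\langle i|U^\dagger ,$$ the expectation being over the randomness of the measurement. -/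

import Mathlib

open MeasureTheory

noncomputable section

namespace RowSym

/-! ### Qudits, weights and permutation operators -/

/-- The space `(ℂ^d)^{⊗n}`, with orthonormal standard basis `|a⟩` indexed by `a : Fin n → Fin d`. -/
abbrev Qudits (d n : ℕ) : Type := EuclideanSpace ℂ (Fin n → Fin d)

/-- Operators on `(ℂ^d)^{⊗n}`, as matrices in the standard basis. -/
abbrev QuditOp (d n : ℕ) : Type := Matrix (Fin n → Fin d) (Fin n → Fin d) ℂ

/-- The standard basis vector `|a⟩ = |a_1, …, a_n⟩`. -/
def ket {d n : ℕ} (a : Fin n → Fin d) : Qudits d n := EuclideanSpace.single a 1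

/-- The action of an operator on a vector. -/
abbrev act {d n : ℕ} (M : QuditOp d n) : Qudits d n →ₗ[ℂ] Qudits d n := Matrix.toEuclideanLin M

/-- The operator `M^{⊗n}`. -/
def tensorPow {d : ℕ} (n : ℕ) (M : Matrix (Fin d) (Fin d) ℂ) : QuditOp d n :=
  Matrix.of fun a b => ∏ q, M (a q) (b q)

/-- The permutation operator `P_π`, which sends `|b_1, …, b_n⟩` to
`|b_{π⁻¹(1)}, …, b_{π⁻¹(n)}⟩`. -/
def permOp {d n : ℕ} (π : Equiv.Perm (Fin n)) : QuditOp d n :=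
  Matrix.of fun a b => if a = b ∘ ⇑π⁻¹ then 1 else 0

/-- The weight vector of `|a⟩`: the number of occurrences of each symbol. -/
def weight {d n : ℕ} (a : Fin n → Fin d) : Fin d → ℕ :=
  fun i => (Finset.univ.filter fun q => a q = i).card

/-- The weight subspace `V(w)`. -/
def weightSpace {d : ℕ} (n : ℕ) (w : Fin d → ℕ) : Submodule ℂ (Qudits d n) :=
  Submodule.span ℂ {x | ∃ a : Fin n → Fin d, weight a = w ∧ x = ket a}

/-- The rank-one operator `|φ⟩⟨φ|`. -/
def stateMatrix {d n : ℕ} (φ : Qudits d n) : QuditOp d n :=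
  Matrix.vecMulVec (fun a => φ a) (fun b => star (φ b))

/-! ### Partitions and the Young symmetrizer -/

/-- A partition `λ ⊢_d n`: a weakly decreasing sequence of at most `d` positive integers that
sum up to `n`. -/
structure DPartition (d n : ℕ) where
  toComposition : Composition n
  antitone_blocks : Antitone toComposition.blocksFun
  length_le : toComposition.length ≤ d

namespace DPartition

variable {d n : ℕ}

/-- The number of parts of the partition. -/
abbrev length (lam : DPartition d n) : ℕ := lam.toComposition.length

/-- The `i`-th part, i.e. the length of the `i`-th row of the Young diagram. -/
abbrev part (lam : DPartition d n) (i : Fin lam.length) : ℕ := lam.toComposition.blocksFun i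

/-- The row of the `q`-th box, when the boxes of the Young diagram are numbered from left to
right and then from top to bottom. -/
abbrev row (lam : DPartition d n) (q : Fin n) : Fin lam.length := lam.toComposition.index q

/-- The column of the `q`-th box. -/
def col (lam : DPartition d n) (q : Fin n) : ℕ := (lam.toComposition.invEmbedding q : ℕ)

/-- The group `A_λ` of the permutations which preserve every row. -/
def rowPerms (lam : DPartition d n) : Finset (Equiv.Perm (Fin n)) :=
  Finset.univ.filter fun π => ∀ q, lam.row (π q) = lam.row q

/-- The group `B_λ` of the permutations which preserve every column. -/
def colPerms (lam : DPartition d n) : Finset (Equiv.Perm (Fin n)) :=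
  Finset.univ.filter fun π => ∀ q, lam.col (π q) = lam.col q

/-- The Young symmetrizer `Y_λ = (∑_{a ∈ A_λ} P_a) (∑_{b ∈ B_λ} sgn(b) P_b)`. -/
def youngSymmetrizer (lam : DPartition d n) : QuditOp d n :=
  (∑ a ∈ lam.rowPerms, permOp a) *
    ∑ b ∈ lam.colPerms, (((Equiv.Perm.sign b : ℤˣ) : ℤ) : ℂ) • permOp b

/-- The canonical irrep `Q_λ`, the image of the Young symmetrizer. -/
def canonicalIrrep (lam : DPartition d n) : Submodule ℂ (Qudits d n) :=
  LinearMap.range (act lam.youngSymmetrizer)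

/-- The dimension of `Q_λ`. -/
def dimQ (lam : DPartition d n) : ℕ := Module.finrank ℂ lam.canonicalIrrep

/-- The operator `Π_sym^{(λ)}`, the average of `P_π` over `π ∈ A_λ`. -/
def symProj (lam : DPartition d n) : QuditOp d n :=
  ((lam.rowPerms.card : ℂ))⁻¹ • ∑ π ∈ lam.rowPerms, permOp π

end DPartition

/-! ### The nice Schur basis -/

variable {d n : ℕ}

/-- The span of all `P_π x`. -/
def permSpan (x : Qudits d n) : Submodule ℂ (Qudits d n) :=
  Submodule.span ℂ (Set.range fun π : Equiv.Perm (Fin n) => act (permOp π) x)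

/-- A family of vectors `|(λ, i, j)⟩`, of which only those with `i < dim Q_λ` and `j < dim P_λ`
are used. -/
abbrev SchurFamily (d n : ℕ) : Type := DPartition d n → ℕ → ℕ → Qudits d n

/-- The dimension of the irrep `P_λ = span {P_π |(λ, 0, 0)⟩}` of the symmetric group. -/
def SchurFamily.dimP (v : SchurFamily d n) (lam : DPartition d n) : ℕ :=
  Module.finrank ℂ (permSpan (v lam 0 0))

/-- `v` is a possible output of the nice Schur basis algorithm (the algorithm chooses several
orthonormal bases arbitrarily). For each `λ`:
* the list of the `|(λ, i, 0)⟩` is a concatenation of orthonormal bases of the spaces `Y_λ V(w)`,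
  with `w` running through the weight vectors in reverse lexicographic order
  (`wt i` is the weight `w` from which `|(λ, i, 0)⟩` comes);
* the vectors `|(λ, 0, j)⟩` are an orthonormal basis of `span {P_π |(λ, 0, 0)⟩}`;
* with coefficients such that `|(λ, 0, j)⟩ = ∑_π α_π^{(j)} P_π |(λ, 0, 0)⟩`, one has
  `|(λ, i, j)⟩ = ∑_π α_π^{(j)} P_π |(λ, i, 0)⟩` for all `i`. -/
def IsNiceSchurBasis (v : SchurFamily d n) : Prop :=
  ∀ lam : DPartition d n,
    (∃ wt : ℕ → Fin d → ℕ,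
      (∀ i i', i ≤ i' → i' < lam.dimQ → toLex (wt i') ≤ toLex (wt i)) ∧
      ∀ w : Fin d → ℕ,
        Orthonormal ℂ (fun i : {i : ℕ // i < lam.dimQ ∧ wt i = w} => v lam i 0) ∧
        Submodule.span ℂ {x | ∃ i < lam.dimQ, wt i = w ∧ x = v lam i 0} =
          (weightSpace n w).map (act lam.youngSymmetrizer)) ∧
    (Orthonormal ℂ (fun j : Fin (v.dimP lam) => v lam 0 j) ∧
      Submodule.span ℂ (Set.range fun j : Fin (v.dimP lam) => v lam 0 j) =
        permSpan (v lam 0 0)) ∧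
    ∃ α : ℕ → Equiv.Perm (Fin n) → ℂ,
      ∀ j < v.dimP lam, ∀ i < lam.dimQ,
        v lam i j = ∑ π, α j π • act (permOp π) (v lam i 0)

/-! ### Generic pre-processing -/

/-- The span of the basis vectors `|(λ, ·, j)⟩`; the Schur projective measurement consists of the
orthogonal projections `Π_{λ,j}` onto these subspaces. -/
def schurBlock (v : SchurFamily d n) (lam : DPartition d n) (j : ℕ) :
    Submodule ℂ (Qudits d n) :=
  Submodule.span ℂ {x | ∃ i < lam.dimQ, x = v lam i j}

/-- `H` is the change of basis `H_{λ,j}`: it swaps `|(λ, i, 0)⟩` and `|(λ, i, j)⟩` for every `i`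
and fixes all the other basis vectors. -/
structure IsBasisSwap (v : SchurFamily d n) (lam : DPartition d n) (j : ℕ)
    (H : Qudits d n →ₗ[ℂ] Qudits d n) : Prop where
  map_zero : ∀ i < lam.dimQ, H (v lam i 0) = v lam i j
  map_self : ∀ i < lam.dimQ, H (v lam i j) = v lam i 0
  map_other : ∀ (mu : DPartition d n) (i l : ℕ), i < mu.dimQ → l < v.dimP mu →
    ¬ (mu = lam ∧ (l = 0 ∨ l = j)) → H (v mu i l) = v mu i l

/-- The generic pre-processing, run on the state `input`, returns with positive probability the
partition `λ` and the state `out`: some outcome `(λ, j)` of the Schur projective measurement with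
`Π_{λ,j} input ≠ 0` leads to the state `H_{λ,j} Π_{λ,j} input`, normalized to a unit vector. -/
def IsPreprocessingOutput (v : SchurFamily d n) (input : Qudits d n)
    (lam : DPartition d n) (out : Qudits d n) : Prop :=
  ∃ j < v.dimP lam, ∃ H : Qudits d n →ₗ[ℂ] Qudits d n, IsBasisSwap v lam j H ∧
    (schurBlock v lam j).starProjection input ≠ 0 ∧
    out = ((‖H ((schurBlock v lam j).starProjection input)‖⁻¹ : ℝ) : ℂ) •
      H ((schurBlock v lam j).starProjection input)

/-! ### Haar random pure states -/

instance instMeasurableSpaceMatrix (d : ℕ) : MeasurableSpace (Matrix (Fin d) (Fin d) ℂ) :=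
  inferInstanceAs (MeasurableSpace (Fin d → Fin d → ℂ))

instance instBorelSpaceMatrix (d : ℕ) : BorelSpace (Matrix (Fin d) (Fin d) ℂ) :=
  inferInstanceAs (BorelSpace (Fin d → Fin d → ℂ))

instance instCompactSpaceUnitaryGroup (d : ℕ) : CompactSpace (Matrix.unitaryGroup (Fin d) ℂ) := by
  refine (isCompact_iff_compactSpace
    (s := (Matrix.unitaryGroup (Fin d) ℂ : Set (Matrix (Fin d) (Fin d) ℂ)))).mp ?_
  have hK : IsCompact (Set.univ.pi fun _ : Fin d => Set.univ.pi fun _ : Fin d =>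
      Metric.closedBall (0 : ℂ) 1) :=
    isCompact_univ_pi fun _ => isCompact_univ_pi fun _ => isCompact_closedBall 0 1
  refine IsCompact.of_isClosed_subset (X := Matrix (Fin d) (Fin d) ℂ) hK ?_ ?_
  · have : ((Matrix.unitaryGroup (Fin d) ℂ : Set (Matrix (Fin d) (Fin d) ℂ))) =
        {A | A * star A = 1} := by
      ext A
      exact Matrix.mem_unitaryGroup_iff
    rw [this]
    exact isClosed_eq (by fun_prop) continuous_const
  · intro A hA
    exact Set.mem_univ_pi.mpr fun i => Set.mem_univ_pi.mpr fun j =>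
      mem_closedBall_zero_iff.mpr (entry_norm_bound_of_unitary hA i j)

/-- The Haar probability measure on the unitary group. -/
def haarUnitary (d : ℕ) : Measure (Matrix.unitaryGroup (Fin d) ℂ) :=
  Measure.haarMeasure ⊤

/-- The measure `μ_H`: the distribution of the density matrix `V |0⟩⟨0| V†` of a pure state,
for a Haar random unitary `V`. -/
def haarState (d : ℕ) [NeZero d] : Measure (Matrix (Fin d) (Fin d) ℂ) :=
  (haarUnitary d).map fun V : Matrix.unitaryGroup (Fin d) ℂ =>
    (V : Matrix (Fin d) (Fin d) ℂ) * Matrix.single 0 0 1 *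
      (V : Matrix (Fin d) (Fin d) ℂ).conjTranspose

/-! ### The row symmetric joint measurement and the estimator -/

/-- The dimension `κ_s` of the symmetric subspace of `s` qudits. -/
def kappa (d s : ℕ) : ℕ := (s + d - 1).choose (d - 1)

/-- The element `F^{(λ)}(ψ_1, …, ψ_k) = ⨂_i κ_{λ_i} ψ_i^{⊗ λ_i}`; the factor `ψ_i` acts on
the qudits of the `i`-th row of the Young diagram. -/
def rowPOVM (lam : DPartition d n) (ψ : Fin lam.length → Matrix (Fin d) (Fin d) ℂ) :
    QuditOp d n :=
  (∏ i, (kappa d (lam.part i) : ℂ)) •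
    Matrix.of fun a b => ∏ q, ψ (lam.row q) (a q) (b q)

/-- Outcomes of the measurement: matrices `(ψ_1, …, ψ_k)` or the outcome "fail". -/
abbrev Outcome (lam : DPartition d n) : Type :=
  (Fin lam.length → Matrix (Fin d) (Fin d) ℂ) ⊕ Unit

/-- The distribution (Born rule) of the outcome of the row symmetric joint measurement on the
state `|φ⟩`: density `tr(F^{(λ)}(ψ) |φ⟩⟨φ|)` with respect to the product Haar measure `μ_H^k`,
and probability `tr((I - Π_sym^{(λ)}) |φ⟩⟨φ|)` for "fail". -/
def outcomeLaw [NeZero d] (lam : DPartition d n) (φ : Qudits d n) : Measure (Outcome lam) :=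
  ((Measure.pi fun _ : Fin lam.length => haarState d).withDensity fun ψ =>
      ENNReal.ofReal (rowPOVM lam ψ * stateMatrix φ).trace.re).map Sum.inl +
    ENNReal.ofReal ((1 - lam.symProj) * stateMatrix φ).trace.re • Measure.dirac (Sum.inr ())

/-- The shadow matrix `Ψ = ∑_i (d + λ_i) ψ_i` (with the convention `0` for the outcome "fail"). -/
def shadow (lam : DPartition d n) : Outcome lam → Matrix (Fin d) (Fin d) ℂ
  | Sum.inl ψ => ∑ i, ((d : ℂ) + (lam.part i : ℂ)) • ψ i
  | Sum.inr _ => 0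

end RowSym

end

open RowSym

/-!
Let `ψ` be a Haar random pure state. By invariance `E[ψ^{⊗s}]` commutes with `U^{⊗s}` for all
unitary `U`; differentiating along skew-Hermitian directions and complexifying, it commutes with
`∑_q X_q`, where `X_q` is any matrix `X` acting on the tensor factor `q`. Tracing out one factor in
these relations for `X = |i⟩⟨j|` expresses `(d + s) E[ψ^{⊗(s+1)}]` through `E[ψ^{⊗s}]`, and this
recursion shows that `κ_s E[ψ^{⊗s}]` is the projector onto the symmetric subspace. Hence the POVM
of the row symmetric measurement integrates to `Π_sym`, and weighting it by `(d + λ_i) ⟨x|ψ_i|y⟩`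
gives `(δ_{xy} + ∑_{q ∈ row i} (|y⟩⟨x|)_q) Π_sym`.

The output of the pre-processing lies in the range of `Y_λ`, so it is fixed by `Π_sym`. Summing over
the rows, `E[Ψ]` is therefore `k I` plus the sum of the one-qudit reduced density matrices of
`U^{⊗n}|τ⟩`. Conjugation by `U` reduces these to the ones of `|τ⟩`, whose sum is `diag(w)` because
changing a single symbol of a basis vector changes its weight.
-/

noncomputable section

namespace RowSym

open Function
open scoped Matrix ComplexOrder

/-! ### Tensor products of matrices -/

section TensorOp

variable {ι α R : Type*} [Fintype ι] [CommSemiring R]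

/-- The operator `⨂_q M_q`, as a matrix in the product basis. -/
def tensorOp (M : ι → Matrix α α R) : Matrix (ι → α) (ι → α) R :=
  Matrix.of fun a b => ∏ q, M q (a q) (b q)

lemma tensorOp_apply (M : ι → Matrix α α R) (a b : ι → α) :
    tensorOp M a b = ∏ q, M q (a q) (b q) := rfl

lemma conjTranspose_tensorOp [StarRing R] (M : ι → Matrix α α R) :
    (tensorOp M)ᴴ = tensorOp fun q => (M q)ᴴ := by
  ext a b
  simp [tensorOp_apply]

lemma tensorOp_one [DecidableEq α] : tensorOp (1 : ι → Matrix α α R) = 1 := by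
  ext a b
  simp only [tensorOp_apply, Pi.one_apply, Matrix.one_apply, Finset.prod_ite_zero,
    Finset.prod_const_one, funext_iff, Finset.mem_univ, true_imp_iff]

variable [Fintype α] [DecidableEq ι]

lemma tensorOp_mul_tensorOp (M N : ι → Matrix α α R) :
    tensorOp M * tensorOp N = tensorOp (M * N) := by
  ext a b
  simp only [tensorOp_apply, Pi.mul_apply, Matrix.mul_apply, Fintype.prod_sum,
    Finset.prod_mul_distrib]

variable [DecidableEq α]

lemma tensorOp_mul_tensorOp_eq_one {U V : Matrix α α R} (h : V * U = 1) :
    tensorOp (fun _ : ι => V) * tensorOp (fun _ : ι => U) = 1 := by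
  rw [tensorOp_mul_tensorOp, ← tensorOp_one]
  exact congrArg _ (funext fun _ => h)

/-- The operator `X` acting on the tensor factor `q`. -/
def localOp (q : ι) (X : Matrix α α R) : Matrix (ι → α) (ι → α) R := tensorOp (Pi.mulSingle q X)

omit [Fintype α] in
lemma localOp_apply (q : ι) (X : Matrix α α R) (a b : ι → α) :
    localOp q X a b =
      (∏ r ∈ Finset.univ.erase q, (1 : Matrix α α R) (a r) (b r)) * X (a q) (b q) := by
  rw [localOp, tensorOp_apply, ← Finset.prod_erase_mul _ _ (Finset.mem_univ q),
    Pi.mulSingle_eq_same]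
  congr 1
  exact Finset.prod_congr rfl fun r hr => by rw [Pi.mulSingle_eq_of_ne (Finset.ne_of_mem_erase hr)]

omit [Fintype α] in
lemma transpose_localOp (q : ι) (X : Matrix α α R) : (localOp q X)ᵀ = localOp q Xᵀ := by
  ext a b
  simp only [Matrix.transpose_apply, localOp_apply, Matrix.one_apply, eq_comm]

lemma localOp_mulVec (q : ι) (X : Matrix α α R) (f : (ι → α) → R) (a : ι → α) :
    (localOp q X *ᵥ f) a = ∑ x, X (a q) x * f (update a q x) := by
  refine (Fintype.sum_of_injective (update a q) (update_injective a q)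
    (fun x => X (a q) x * f (update a q x)) (fun c => localOp q X a c * f c) ?_ ?_).symm
  · intro c hc
    obtain ⟨r, hrq, hr⟩ : ∃ r ≠ q, a r ≠ c r := by
      by_contra! h
      exact hc ⟨c q, (eq_update_iff.mpr ⟨rfl, fun r hr => (h r hr).symm⟩).symm⟩
    have hzero : ∏ r ∈ Finset.univ.erase q, (1 : Matrix α α R) (a r) (c r) = 0 :=
      Finset.prod_eq_zero (Finset.mem_erase.mpr ⟨hrq, Finset.mem_univ r⟩) (Matrix.one_apply_ne hr)
    rw [localOp_apply, hzero, zero_mul, zero_mul]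
  · intro x
    rw [localOp_apply, Finset.prod_eq_one, one_mul, update_self]
    intro r hr
    rw [update_of_ne (Finset.ne_of_mem_erase hr), Matrix.one_apply_eq]

variable {m : Type*}

lemma localOp_mul_apply (q : ι) (X : Matrix α α R) (M : Matrix (ι → α) m R) (a : ι → α) (b : m) :
    (localOp q X * M) a b = ∑ x, X (a q) x * M (update a q x) b :=
  localOp_mulVec q X (fun c => M c b) a

lemma mul_localOp_apply (q : ι) (X : Matrix α α R) (M : Matrix m (ι → α) R) (a : m) (b : ι → α) :
    (M * localOp q X) a b = ∑ x, X x (b q) * M a (update b q x) := by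
  rw [← Matrix.transpose_apply (M * _), Matrix.transpose_mul, transpose_localOp, localOp_mul_apply]
  rfl

lemma localOp_single_mul_apply (q : ι) (i j : α) (M : Matrix (ι → α) m R) (a : ι → α) (b : m) :
    (localOp q (Matrix.single i j (1 : R)) * M) a b =
      if a q = i then M (update a q j) b else 0 := by
  rw [localOp_mul_apply, Fintype.sum_eq_single j fun x hx => by simp [hx.symm],
    Matrix.single_apply]
  simp only [and_true, ite_mul, one_mul, zero_mul, eq_comm]

lemma mul_localOp_single_apply (q : ι) (i j : α) (M : Matrix m (ι → α) R) (a : m) (b : ι → α) :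
    (M * localOp q (Matrix.single i j (1 : R))) a b =
      if b q = j then M a (update b q i) else 0 := by
  rw [mul_localOp_apply, Fintype.sum_eq_single i fun x hx => by simp [hx.symm],
    Matrix.single_apply]
  simp only [true_and, ite_mul, one_mul, zero_mul, eq_comm]

lemma tensorOp_mul_localOp_mul_tensorOp {U V : Matrix α α R} (h : V * U = 1) (q : ι)
    (X : Matrix α α R) :
    tensorOp (fun _ : ι => V) * localOp q X * tensorOp (fun _ : ι => U) =
      localOp q (V * X * U) := by
  rw [localOp, tensorOp_mul_tensorOp, tensorOp_mul_tensorOp, localOp]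
  congr 1
  funext r
  rcases eq_or_ne r q with rfl | hr
  · simp
  · simp [hr, h]

/-- The operator `∑_q 1 ⊗ ⋯ ⊗ X ⊗ ⋯ ⊗ 1`, with `X` acting on the factor `q`. It is the
derivative of `U ↦ U^{⊗ι}` at the identity in direction `X`. -/
def collectiveOp (ι : Type*) [Fintype ι] [DecidableEq ι] :
    Matrix α α R →ₗ[R] Matrix (ι → α) (ι → α) R where
  toFun X := ∑ q, localOp q X
  map_add' X Y := by
    rw [← Finset.sum_add_distrib]
    exact Finset.sum_congr rfl fun q _ => by ext a b; simp [localOp_apply, mul_add]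
  map_smul' c X := by
    rw [RingHom.id_apply, Finset.smul_sum]
    exact Finset.sum_congr rfl fun q _ => by ext a b; simp [localOp_apply, mul_left_comm]

omit [Fintype α] in
lemma collectiveOp_apply (X : Matrix α α R) : collectiveOp ι X = ∑ q, localOp q X := rfl

lemma tensorOp_mul_collectiveOp_mul_tensorOp {U V : Matrix α α R} (h : V * U = 1)
    (X : Matrix α α R) :
    tensorOp (fun _ : ι => V) * collectiveOp ι X * tensorOp (fun _ : ι => U) =
      collectiveOp ι (V * X * U) := by
  simp only [collectiveOp_apply, Finset.mul_sum, Finset.sum_mul,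
    tensorOp_mul_localOp_mul_tensorOp h]

end TensorOp

/-! ### One-body matrices -/

section OneBodyMatrix

variable {ι α R : Type*} [Fintype ι] [DecidableEq ι] [Fintype α] [DecidableEq α] [CommSemiring R]

/-- The sum over `q` of the partial traces of `ρ` over all the factors except the factor `q`, given
by its pairing with one-body observables (see `trace_collectiveOp_mul`). -/
def oneBodyMatrix (ρ : Matrix (ι → α) (ι → α) R) : Matrix α α R :=
  Matrix.of fun x y => (collectiveOp ι (Matrix.single y x 1) * ρ).trace

lemma oneBodyMatrix_apply (ρ : Matrix (ι → α) (ι → α) R) (x y : α) :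
    oneBodyMatrix ρ x y = (collectiveOp ι (Matrix.single y x 1) * ρ).trace := rfl

lemma oneBodyMatrix_apply_eq_sum (ρ : Matrix (ι → α) (ι → α) R) (x y : α) :
    oneBodyMatrix ρ x y = ∑ q, ∑ a, if a q = y then ρ (update a q x) a else 0 := by
  rw [oneBodyMatrix_apply, collectiveOp_apply, Matrix.sum_mul, Matrix.trace_sum]
  exact Finset.sum_congr rfl fun q _ => Finset.sum_congr rfl fun a _ =>
    localOp_single_mul_apply q y x ρ a a

lemma trace_collectiveOp_mul (X : Matrix α α R) (ρ : Matrix (ι → α) (ι → α) R) :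
    (collectiveOp ι X * ρ).trace = (X * oneBodyMatrix ρ).trace := by
  conv_lhs => rw [Matrix.matrix_eq_sum_single X]
  have hsingle : ∀ i j, Matrix.single i j (X i j) = X i j • Matrix.single i j 1 := fun i j => by
    rw [Matrix.smul_single, smul_eq_mul, mul_one]
  simp only [hsingle, map_sum, map_smul, Finset.sum_mul, Matrix.trace_sum, Matrix.smul_mul,
    Matrix.trace_smul, ← oneBodyMatrix_apply, smul_eq_mul]
  rfl

lemma oneBodyMatrix_tensorOp_mul_mul_tensorOp {U V : Matrix α α R} (h : V * U = 1)
    (ρ : Matrix (ι → α) (ι → α) R) :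
    oneBodyMatrix (tensorOp (fun _ => U) * ρ * tensorOp fun _ => V) = U * oneBodyMatrix ρ * V := by
  refine Matrix.ext_iff_trace_mul_left.mpr fun X => ?_
  calc (X * oneBodyMatrix (tensorOp (fun _ => U) * ρ * tensorOp fun _ => V)).trace
      = (collectiveOp ι X * (tensorOp (fun _ => U) * ρ * tensorOp fun _ => V)).trace :=
        (trace_collectiveOp_mul X _).symm
    _ = (tensorOp (fun _ => V) * collectiveOp ι X * tensorOp (fun _ => U) * ρ).trace := by
        rw [← Matrix.mul_assoc, Matrix.trace_mul_comm]
        simp only [Matrix.mul_assoc]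
    _ = (V * X * U * oneBodyMatrix ρ).trace := by
        rw [tensorOp_mul_collectiveOp_mul_tensorOp h, trace_collectiveOp_mul]
    _ = (X * (U * oneBodyMatrix ρ * V)).trace := by
        rw [← Matrix.mul_assoc, ← Matrix.mul_assoc, Matrix.trace_mul_comm _ V]
        simp only [Matrix.mul_assoc]

omit [Fintype ι] [DecidableEq ι] in
lemma mul_diagonal_mul_eq_sum_smul (A B : Matrix α α R) (w : α → R) :
    A * Matrix.diagonal w * B = ∑ i, w i • (A * Matrix.single i i 1 * B) := by
  have hsingle : ∀ i, Matrix.single i i (w i) = w i • Matrix.single i i 1 := fun i => by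
    rw [Matrix.smul_single, smul_eq_mul, mul_one]
  simp only [← Matrix.sum_single_eq_diagonal, hsingle, Finset.mul_sum, Finset.sum_mul,
    Matrix.mul_smul, Matrix.smul_mul]

end OneBodyMatrix

/-! ### The commutant of the tensor powers of unitary matrices -/

section Commutant

attribute [local instance] Matrix.linftyOpNormedRing Matrix.linftyOpNormedAlgebra

variable {ι α : Type*} [Fintype ι] [DecidableEq ι] [Fintype α] [DecidableEq α]

lemma exp_smul_mem_unitaryGroup {X : Matrix α α ℂ} (hX : Xᴴ = -X) (t : ℝ) :
    NormedSpace.exp (t • X) ∈ Matrix.unitaryGroup α ℂ := by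
  rw [Matrix.mem_unitaryGroup_iff, Matrix.star_eq_conjTranspose, ← Matrix.exp_conjTranspose,
    Matrix.conjTranspose_smul, hX, star_trivial, smul_neg, ← Matrix.exp_add_of_commute _ _
      (Commute.refl (t • X)).neg_right, add_neg_cancel, NormedSpace.exp_zero]

lemma hasDerivAt_exp_smul_apply (X : Matrix α α ℂ) (x y : α) :
    HasDerivAt (fun t : ℝ => NormedSpace.exp (t • X) x y) (X x y) 0 := by
  have h := hasDerivAt_exp_smul_const (𝕂 := ℝ) X 0
  rw [zero_smul, NormedSpace.exp_zero, one_mul] at h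
  exact hasDerivAt_pi.mp (hasDerivAt_pi.mp h x) y

lemma hasDerivAt_tensorOp_exp_smul_apply (X : Matrix α α ℂ) (a b : ι → α) :
    HasDerivAt (fun t : ℝ => tensorOp (fun _ => NormedSpace.exp (t • X)) a b)
      (collectiveOp ι X a b) 0 := by
  simp_rw [collectiveOp_apply, Matrix.sum_apply, localOp_apply, tensorOp_apply]
  simpa only [zero_smul, NormedSpace.exp_zero, smul_eq_mul] using
    HasDerivAt.fun_finsetProd fun q _ => hasDerivAt_exp_smul_apply X (a q) (b q)

lemma commute_collectiveOp_of_conjTranspose_eq_neg {M : Matrix (ι → α) (ι → α) ℂ}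
    (hM : ∀ U ∈ Matrix.unitaryGroup α ℂ, Commute (tensorOp fun _ => U) M)
    {X : Matrix α α ℂ} (hX : Xᴴ = -X) : Commute (collectiveOp ι X) M := by
  have hleft : ∀ a b, HasDerivAt
      (fun t : ℝ => ((tensorOp fun _ => NormedSpace.exp (t • X)) * M :
        Matrix (ι → α) (ι → α) ℂ) a b)
      ((collectiveOp ι X * M) a b) 0 := fun a b =>
    HasDerivAt.fun_sum fun c _ => (hasDerivAt_tensorOp_exp_smul_apply X a c).mul_const (M c b)
  have hright : ∀ a b, HasDerivAt
      (fun t : ℝ => (M * tensorOp fun _ => NormedSpace.exp (t • X) :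
        Matrix (ι → α) (ι → α) ℂ) a b)
      ((M * collectiveOp ι X) a b) 0 := fun a b =>
    HasDerivAt.fun_sum fun c _ => (hasDerivAt_tensorOp_exp_smul_apply X c b).const_mul (M a c)
  ext a b
  refine (hleft a b).unique ?_
  simpa only [(hM _ (exp_smul_mem_unitaryGroup hX _)).eq] using hright a b

lemma commute_collectiveOp {M : Matrix (ι → α) (ι → α) ℂ}
    (hM : ∀ U ∈ Matrix.unitaryGroup α ℂ, Commute (tensorOp fun _ => U) M) (X : Matrix α α ℂ) :
    Commute (collectiveOp ι X) M := by
  have hselfAdjoint : ∀ H : selfAdjoint (Matrix α α ℂ), Commute (collectiveOp ι H.1) M := by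
    intro H
    have hskew : (Complex.I • H.1)ᴴ = -(Complex.I • H.1) := by
      rw [Matrix.conjTranspose_smul, ← Matrix.star_eq_conjTranspose, H.2.star_eq]
      simp
    have h := (commute_collectiveOp_of_conjTranspose_eq_neg hM hskew).smul_left (-Complex.I)
    simpa [map_smul, smul_smul] using h
  rw [← realPart_add_I_smul_imaginaryPart X, map_add, map_smul]
  exact (hselfAdjoint _).add_left ((hselfAdjoint _).smul_left _)

end Commutant

/-! ### Entrywise integrals of matrices -/

section MatrixIntegral

variable {X l m n : Type*} [MeasurableSpace X] {μ : Measure X} {f : X → Matrix m n ℂ}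

/-- The entrywise integral of a matrix-valued function; this avoids the choice of a matrix norm
that the Bochner integral would require. -/
def matrixIntegral (μ : Measure X) (f : X → Matrix m n ℂ) : Matrix m n ℂ :=
  Matrix.of fun i j => ∫ x, f x i j ∂μ

lemma matrixIntegral_apply (i : m) (j : n) : matrixIntegral μ f i j = ∫ x, f x i j ∂μ := rfl

lemma mul_matrixIntegral [Fintype m] (A : Matrix l m ℂ)
    (hf : ∀ i j, Integrable (fun x => f x i j) μ) :
    A * matrixIntegral μ f = matrixIntegral μ fun x => A * f x := by
  ext i j
  simp only [matrixIntegral_apply, Matrix.mul_apply]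
  rw [integral_finsetSum _ fun k _ => (hf k j).const_mul _]
  simp only [integral_const_mul]

lemma matrixIntegral_mul [Fintype n] (A : Matrix n l ℂ)
    (hf : ∀ i j, Integrable (fun x => f x i j) μ) :
    matrixIntegral μ f * A = matrixIntegral μ fun x => f x * A := by
  ext i j
  simp only [matrixIntegral_apply, Matrix.mul_apply]
  rw [integral_finsetSum _ fun k _ => (hf i k).mul_const _]
  simp only [integral_mul_const]

lemma trace_matrixIntegral [Fintype n] {f : X → Matrix n n ℂ}
    (hf : ∀ i, Integrable (fun x => f x i i) μ) :
    (matrixIntegral μ f).trace = ∫ x, (f x).trace ∂μ :=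
  (integral_finsetSum _ fun i _ => hf i).symm

end MatrixIntegral

/-! ### Haar random pure states -/

section HaarState

lemma integrable_of_continuous_of_ae_mem_isCompact {X E : Type*} [TopologicalSpace X]
    [MeasurableSpace X] [OpensMeasurableSpace X] [T2Space X] [NormedAddCommGroup E]
    [SecondCountableTopologyEither X E] {μ : Measure X} [IsFiniteMeasure μ] {K : Set X}
    (hK : IsCompact K) (hμ : ∀ᵐ x ∂μ, x ∈ K) {g : X → E} (hg : Continuous g) : Integrable g μ := by
  rw [← Measure.restrict_eq_self_of_ae_mem hμ]
  exact hg.continuousOn.integrableOn_compact hK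

variable {d : ℕ}

instance : IsProbabilityMeasure (haarUnitary d) :=
  ⟨by simpa only [haarUnitary, TopologicalSpace.PositiveCompacts.coe_top] using
    Measure.haarMeasure_self (K₀ := (⊤ : TopologicalSpace.PositiveCompacts
      (Matrix.unitaryGroup (Fin d) ℂ)))⟩

instance : (haarUnitary d).IsMulLeftInvariant := by
  unfold haarUnitary
  infer_instance

instance : SecondCountableTopology (Matrix (Fin d) (Fin d) ℂ) :=
  inferInstanceAs (SecondCountableTopology (Fin d → Fin d → ℂ))

variable [NeZero d]

/-- The density matrix `V |0⟩⟨0| V†`, whose distribution for a Haar random `V` is `haarState`. -/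
def pureState (V : Matrix.unitaryGroup (Fin d) ℂ) : Matrix (Fin d) (Fin d) ℂ :=
  (V : Matrix (Fin d) (Fin d) ℂ) * Matrix.single 0 0 1 *
    (V : Matrix (Fin d) (Fin d) ℂ).conjTranspose

lemma haarState_eq_map : haarState d = (haarUnitary d).map pureState := rfl

lemma pureState_eq_vecMulVec (V : Matrix.unitaryGroup (Fin d) ℂ) :
    pureState V = Matrix.vecMulVec (fun x => V.1 x 0) (star fun x => V.1 x 0) := by
  ext x y
  simp [pureState, Matrix.single_eq_single_vecMulVec_single, Matrix.mul_vecMulVec,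
    Matrix.vecMulVec_mul, Matrix.vecMulVec_apply]

lemma pureState_eq_mul_conjTranspose (V : Matrix.unitaryGroup (Fin d) ℂ) :
    pureState V = V.1 * Matrix.single 0 0 1 * (V.1 * Matrix.single 0 0 1)ᴴ := by
  simp [pureState, Matrix.mul_assoc,
    ← Matrix.mul_assoc (Matrix.single _ _ _) (Matrix.single _ _ _)]

lemma trace_pureState (V : Matrix.unitaryGroup (Fin d) ℂ) : (pureState V).trace = 1 := by
  rw [pureState, Matrix.trace_mul_comm, ← Matrix.mul_assoc, ← Matrix.star_eq_conjTranspose,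
    Unitary.coe_star_mul_self, Matrix.one_mul, Matrix.trace_single_eq_same]

lemma pureState_mul (U V : Matrix.unitaryGroup (Fin d) ℂ) :
    pureState (U * V) = U.1 * pureState V * U.1ᴴ := by
  simp only [pureState, Submonoid.coe_mul, Matrix.conjTranspose_mul, Matrix.mul_assoc]

lemma continuous_pureState : Continuous (pureState (d := d)) := by
  unfold pureState
  fun_prop

instance : IsProbabilityMeasure (haarState d) :=
  Measure.isProbabilityMeasure_map continuous_pureState.aemeasurable

lemma map_conj_haarState (U : Matrix.unitaryGroup (Fin d) ℂ) :
    (haarState d).map (fun ψ => U.1 * ψ * U.1ᴴ) = haarState d := by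
  have hconj : Continuous fun ψ : Matrix (Fin d) (Fin d) ℂ => U.1 * ψ * U.1ᴴ := by fun_prop
  rw [haarState_eq_map, Measure.map_map hconj.measurable continuous_pureState.measurable]
  conv_rhs => rw [← map_mul_left_eq_self (haarUnitary d) U,
    Measure.map_map continuous_pureState.measurable (measurable_const_mul U)]
  exact congrArg (Measure.map · (haarUnitary d)) (funext fun V => (pureState_mul U V).symm)

lemma isCompact_range_pureState : IsCompact (Set.range (pureState (d := d))) :=
  isCompact_range continuous_pureState

lemma ae_mem_range_pureState : ∀ᵐ ψ ∂haarState d, ψ ∈ Set.range pureState :=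
  ae_map_mem_range _ isCompact_range_pureState.measurableSet _

lemma integrable_haarState {g : Matrix (Fin d) (Fin d) ℂ → ℂ} (hg : Continuous g) :
    Integrable g (haarState d) :=
  integrable_of_continuous_of_ae_mem_isCompact isCompact_range_pureState ae_mem_range_pureState hg

variable {κ : Type*} [Fintype κ]

lemma ae_pi_mem_range_pureState :
    ∀ᵐ ψ ∂Measure.pi fun _ : κ => haarState d, ∀ i, ψ i ∈ Set.range pureState :=
  Filter.eventually_all.mpr fun _ =>
    Measure.tendsto_eval_ae_ae.eventually (ae_mem_range_pureState (d := d))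

lemma integrable_pi_haarState {g : (κ → Matrix (Fin d) (Fin d) ℂ) → ℂ} (hg : Continuous g) :
    Integrable g (Measure.pi fun _ => haarState d) :=
  integrable_of_continuous_of_ae_mem_isCompact
    (isCompact_univ_pi fun _ => isCompact_range_pureState)
    (ae_pi_mem_range_pureState.mono fun _ hψ i _ => hψ i) hg

end HaarState

/-! ### Moments of Haar random pure states -/

section HaarMoment

variable {d : ℕ} [NeZero d] {ι : Type*} [Fintype ι]

/-- The averaged state `∫ ψ^{⊗ι} dμ_H(ψ)`. -/
def haarMoment (d : ℕ) [NeZero d] (ι : Type*) [Fintype ι] :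
    Matrix (ι → Fin d) (ι → Fin d) ℂ :=
  matrixIntegral (haarState d) fun ψ => tensorOp fun _ => ψ

lemma haarMoment_apply (a b : ι → Fin d) :
    haarMoment d ι a b = ∫ ψ, tensorOp (fun _ => ψ) a b ∂haarState d := rfl

lemma integrable_tensorOp_haarState (a b : ι → Fin d) :
    Integrable (fun ψ => tensorOp (fun _ => ψ) a b) (haarState d) :=
  integrable_haarState (by unfold tensorOp; fun_prop)

lemma haarMoment_apply_comp_equiv {κ : Type*} [Fintype κ] (e : κ ≃ ι) (a b : ι → Fin d) :
    haarMoment d κ (a ∘ e) (b ∘ e) = haarMoment d ι a b := by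
  simp only [haarMoment_apply, tensorOp_apply, comp_apply]
  exact congrArg _ (funext fun ψ => Equiv.prod_comp e fun q => ψ (a q) (b q))

-- The entries of a rank-one `ψ` factor as `v x * star (v y)`.
lemma haarMoment_apply_comp_perm_left (σ : Equiv.Perm ι) (a b : ι → Fin d) :
    haarMoment d ι (a ∘ σ) b = haarMoment d ι a b := by
  refine integral_congr_ae (ae_mem_range_pureState.mono ?_)
  rintro _ ⟨V, rfl⟩
  simp only [tensorOp_apply, comp_apply, pureState_eq_vecMulVec, Matrix.vecMulVec_apply,
    Finset.prod_mul_distrib]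
  rw [Equiv.prod_comp σ fun q => V.1 (a q) 0]

lemma haarMoment_apply_comp_perm_right (σ : Equiv.Perm ι) (a b : ι → Fin d) :
    haarMoment d ι a (b ∘ σ) = haarMoment d ι a b := by
  rw [← haarMoment_apply_comp_perm_left σ, haarMoment_apply_comp_equiv]

variable [DecidableEq ι]

lemma commute_tensorOp_haarMoment {U : Matrix (Fin d) (Fin d) ℂ}
    (hU : U ∈ Matrix.unitaryGroup (Fin d) ℂ) :
    Commute (tensorOp fun _ => U) (haarMoment d ι) := by
  have hconj : (tensorOp fun _ : ι => U) * haarMoment d ι * (tensorOp fun _ => Uᴴ) =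
      haarMoment d ι := by
    rw [haarMoment, mul_matrixIntegral _ integrable_tensorOp_haarState, matrixIntegral_mul _
      fun a b => integrable_haarState (by unfold tensorOp; fun_prop)]
    conv_rhs => rw [← map_conj_haarState ⟨U, hU⟩]
    ext a b
    rw [matrixIntegral_apply, matrixIntegral_apply, integral_map (by fun_prop)
      (Continuous.measurable (by unfold tensorOp; fun_prop)).aestronglyMeasurable]
    simp only [tensorOp_mul_tensorOp]
    rfl
  have hinv : (tensorOp fun _ : ι => Uᴴ) * (tensorOp fun _ => U) = 1 :=
    tensorOp_mul_tensorOp_eq_one (Matrix.mem_unitaryGroup_iff'.mp hU)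
  rw [commute_iff_eq]
  conv_rhs => rw [← hconj, Matrix.mul_assoc, hinv, Matrix.mul_one]

lemma commute_collectiveOp_haarMoment (X : Matrix (Fin d) (Fin d) ℂ) :
    Commute (collectiveOp ι X) (haarMoment d ι) :=
  commute_collectiveOp (fun _ => commute_tensorOp_haarMoment) X

lemma sum_haarMoment_update_none (a b : Option ι → Fin d) :
    ∑ c, haarMoment d (Option ι) (update a none c) (update b none c) =
      haarMoment d ι (a ∘ some) (b ∘ some) := by
  simp only [haarMoment_apply]
  rw [← integral_finsetSum _ fun c _ => integrable_tensorOp_haarState _ _]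
  refine integral_congr_ae (ae_mem_range_pureState.mono ?_)
  rintro _ ⟨V, rfl⟩
  have htrace : ∑ c, pureState V c c = 1 := trace_pureState V
  simp [tensorOp_apply, Fintype.prod_option, ← Finset.sum_mul, htrace]

lemma sum_haarMoment_update_left (a b : Option ι → Fin d) (o : Option ι) :
    ∑ c, haarMoment d (Option ι) (update a o c) (update b none c) =
      haarMoment d ι ((a ∘ Equiv.swap none o) ∘ some) (b ∘ some) := by
  rw [← sum_haarMoment_update_none]
  refine Finset.sum_congr rfl fun c _ => ?_
  rw [← haarMoment_apply_comp_perm_left (Equiv.swap none o) (update a o c),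
    update_comp_equiv, Equiv.symm_swap, Equiv.swap_apply_right]

lemma sum_haarMoment_update_right (a b : Option ι → Fin d) :
    ∑ c, ∑ o, (if update b none c o = c then
      haarMoment d (Option ι) a (update (update b none c) o (b none)) else 0) =
      ((d : ℂ) + Fintype.card ι) * haarMoment d (Option ι) a b := by
  have hsome : ∀ q : ι, ∑ c, (if update b none c (some q) = c then
      haarMoment d (Option ι) a (update (update b none c) (some q) (b none)) else 0) =
      haarMoment d (Option ι) a b := by
    intro q
    rw [← haarMoment_apply_comp_perm_right (Equiv.swap (some q) none) a b,
      Equiv.comp_swap_eq_update]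
    simp only [update_of_ne (Option.some_ne_none q), Finset.sum_ite_eq, Finset.mem_univ, if_true]
  rw [Finset.sum_comm, Fintype.sum_option, Fintype.sum_congr _ _ hsome]
  simp [add_mul]

-- Compare the `(a, update b none c)` entries of the commutation relation for `|b none⟩⟨c|`, and
-- sum over `c`.
lemma haarMoment_option_apply (a b : Option ι → Fin d) :
    ((d : ℂ) + Fintype.card ι) * haarMoment d (Option ι) a b =
      ∑ o, if a o = b none then
        haarMoment d ι ((a ∘ Equiv.swap none o) ∘ some) (b ∘ some) else 0 := by
  have hcomm : ∀ c, ∑ o, (if a o = b none then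
      haarMoment d (Option ι) (update a o c) (update b none c) else 0) =
      ∑ o, if update b none c o = c then
        haarMoment d (Option ι) a (update (update b none c) o (b none)) else 0 := by
    intro c
    have h := congrFun₂ (commute_collectiveOp_haarMoment (Matrix.single (b none) c 1)).eq a
      (update b none c)
    simpa only [collectiveOp_apply, Matrix.sum_mul, Matrix.mul_sum, Matrix.sum_apply,
      localOp_single_mul_apply, mul_localOp_single_apply] using h
  rw [← sum_haarMoment_update_right, ← Fintype.sum_congr _ _ hcomm, Finset.sum_comm]
  refine Finset.sum_congr rfl fun o _ => ?_
  rw [← sum_haarMoment_update_left]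
  split_ifs <;> simp only [Finset.sum_const_zero]

lemma smul_matrixIntegral_smul_tensorOp (x y : Fin d) :
    ((d : ℂ) + Fintype.card ι) • matrixIntegral (haarState d)
        (fun ψ => ψ x y • tensorOp fun _ : ι => ψ) =
      ((1 : Matrix (Fin d) (Fin d) ℂ) x y • 1 + collectiveOp ι (Matrix.single y x 1)) *
        haarMoment d ι := by
  ext a b
  have hoption := haarMoment_option_apply (fun o => o.elim x a) (fun o : Option ι => o.elim y b)
  have hintegral : haarMoment d (Option ι) (fun o => o.elim x a) (fun o => o.elim y b) =
      matrixIntegral (haarState d) (fun ψ => ψ x y • tensorOp fun _ : ι => ψ) a b := by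
    simp [haarMoment_apply, matrixIntegral_apply, tensorOp_apply, Fintype.prod_option]
  have hswap : ∀ q, (((fun o : Option ι => o.elim x a) ∘ Equiv.swap none (some q)) ∘ some) =
      update a q x := by
    intro q
    funext s
    rcases eq_or_ne s q with rfl | hs
    · simp
    · simp [hs, Equiv.swap_apply_of_ne_of_ne]
  rw [Matrix.smul_apply, smul_eq_mul, ← hintegral, hoption, Fintype.sum_option, Matrix.add_mul,
    Matrix.smul_mul, Matrix.one_mul, Matrix.add_apply, Matrix.smul_apply, collectiveOp_apply,
    Matrix.sum_mul, Matrix.sum_apply]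
  simp only [localOp_single_mul_apply, hswap]
  simp [Matrix.one_apply, show (fun o : Option ι => o.elim y b) ∘ some = b from rfl,
    show (fun o : Option ι => o.elim x a) ∘ some = a from rfl]

lemma ascFactorial_mul_haarMoment_apply (a b : ι → Fin d) :
    (d.ascFactorial (Fintype.card ι) : ℂ) * haarMoment d ι a b =
      ∑ π : Equiv.Perm ι, if a ∘ π = b then 1 else 0 := by
  revert a b
  rename_i inst
  revert inst
  refine Fintype.induction_empty_option (P := fun ι _ => ∀ [DecidableEq ι] (a b : ι → Fin d),
    (d.ascFactorial (Fintype.card ι) : ℂ) * haarMoment d ι a b =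
      ∑ π : Equiv.Perm ι, if a ∘ π = b then 1 else 0) ?_ ?_ ?_ ι
  · intro ι κ _ e ih _ a b
    classical
    let _ : Fintype ι := Fintype.ofEquiv κ e.symm
    rw [← haarMoment_apply_comp_equiv e, ← Fintype.card_congr e, ih]
    refine Fintype.sum_equiv e.permCongr _ _ fun π => if_congr ?_ rfl rfl
    rw [← e.surjective.injective_comp_right.eq_iff]
    exact Eq.congr (funext fun q => by simp) rfl
  · intro _ a b
    simp [haarMoment_apply, tensorOp_apply, eq_iff_true_of_subsingleton]
  · intro ι _ ih _ a b
    classical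
    rw [Fintype.card_option, Nat.ascFactorial_succ]
    push_cast
    rw [mul_right_comm, haarMoment_option_apply, Finset.sum_mul,
      ← Equiv.sum_comp Equiv.Perm.decomposeOption.symm, Fintype.sum_prod_type]
    refine Finset.sum_congr rfl fun o _ => ?_
    rw [ite_mul, zero_mul, mul_comm, ih]
    split_ifs with ho
    · refine Finset.sum_congr rfl fun σ _ => if_congr ?_ rfl rfl
      simp only [funext_iff, Option.forall]
      simp [ho]
    · refine (Finset.sum_eq_zero fun σ _ => if_neg fun h => ho ?_).symm
      simpa using congrFun h none

omit [NeZero d] in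
lemma kappa_mul_factorial (hd : d ≠ 0) (s : ℕ) : kappa d s * s.factorial = d.ascFactorial s := by
  obtain ⟨m, rfl⟩ := Nat.exists_eq_succ_of_ne_zero hd
  rw [Nat.ascFactorial_eq_factorial_mul_choose, kappa, mul_comm, Nat.succ_sub_one,
    Nat.add_succ_sub_one, add_comm s, Nat.choose_symm_add]

lemma kappa_mul_haarMoment_apply (a b : ι → Fin d) :
    (kappa d (Fintype.card ι) : ℂ) * haarMoment d ι a b =
      ((Fintype.card ι).factorial : ℂ)⁻¹ * ∑ π : Equiv.Perm ι, if a ∘ π = b then 1 else 0 := by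
  have hfac : ((Fintype.card ι).factorial : ℂ) ≠ 0 := by exact_mod_cast Nat.factorial_ne_zero _
  rw [← ascFactorial_mul_haarMoment_apply, ← kappa_mul_factorial (NeZero.ne d)]
  push_cast
  field_simp

end HaarMoment

/-! ### Moments of independent Haar random pure states -/

section ProductMoment

variable {d : ℕ} {κ ι : Type*} [DecidableEq κ] [Fintype ι]

lemma tensorOp_comp_apply [Fintype κ] (r : ι → κ) (ψ : κ → Matrix (Fin d) (Fin d) ℂ)
    (a b : ι → Fin d) :
    tensorOp (fun q => ψ (r q)) a b =
      ∏ i, tensorOp (fun _ : {q // r q = i} => ψ i) (a ∘ (↑)) (b ∘ (↑)) := by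
  simp only [tensorOp_apply]
  rw [← Fintype.prod_fiberwise r]
  exact Finset.prod_congr rfl fun i _ => Finset.prod_congr rfl fun q _ => by rw [q.2]; rfl

/-- Permutations that preserve every fibre of `r` are families of permutations of the fibres. -/
def fiberwisePermEquiv (r : ι → κ) :
    {π : Equiv.Perm ι // r ∘ π = r} ≃ ∀ i, Equiv.Perm {q // r q = i} :=
  (Equiv.subtypeEquiv DomMulAct.mk fun _ => Iff.rfl).trans
    (MulOpposite.opEquiv.trans (DomMulAct.stabilizerMulEquiv r).toEquiv)

lemma prod_sum_perm_fiber [Fintype κ] [DecidableEq ι] {α : Type*} [DecidableEq α] (r : ι → κ)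
    (a b : ι → α) :
    (∏ i, ∑ p : Equiv.Perm {q // r q = i}, if (a ∘ (↑)) ∘ p = b ∘ (↑) then (1 : ℂ) else 0) =
      ∑ π : {π : Equiv.Perm ι // r ∘ π = r}, if a ∘ π.1 = b then 1 else 0 := by
  rw [Fintype.prod_sum]
  refine (Fintype.sum_equiv (fiberwisePermEquiv r) _ _ fun π => ?_).symm
  rw [Finset.prod_ite_zero, Finset.prod_const_one]
  have hiff : (∀ i ∈ Finset.univ, (a ∘ (↑)) ∘ fiberwisePermEquiv r π i = b ∘ (↑)) ↔ a ∘ π.1 = b :=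
    ⟨fun h => funext fun q => congrFun (h (r q) (Finset.mem_univ _)) ⟨q, rfl⟩,
      by rintro rfl i -; rfl⟩
  simp only [hiff]

variable [NeZero d] [Fintype κ]

/-- The average of `⨂_q ψ_{r q}` over independent Haar random pure states `ψ_i`. -/
def productMoment (d : ℕ) [NeZero d] (r : ι → κ) : Matrix (ι → Fin d) (ι → Fin d) ℂ :=
  matrixIntegral (Measure.pi fun _ => haarState d) fun ψ => tensorOp fun q => ψ (r q)

lemma productMoment_apply (r : ι → κ) (a b : ι → Fin d) :
    productMoment d r a b =
      ∏ i, haarMoment d {q // r q = i} (a ∘ (↑)) (b ∘ (↑)) := by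
  simp only [productMoment, matrixIntegral_apply, haarMoment_apply, tensorOp_comp_apply r]
  exact integral_fintype_prod_eq_prod (𝕜 := ℂ) (μ := fun _ : κ => haarState d)
    fun i ψ => tensorOp (fun _ : {q // r q = i} => ψ) (a ∘ (↑)) (b ∘ (↑))

variable [DecidableEq ι]

lemma prod_kappa_smul_productMoment_apply (r : ι → κ) (a b : ι → Fin d) :
    (∏ i, (kappa d (Fintype.card {q // r q = i}) : ℂ)) * productMoment d r a b =
      (Fintype.card {π : Equiv.Perm ι // r ∘ π = r} : ℂ)⁻¹ *
        ∑ π : {π : Equiv.Perm ι // r ∘ π = r}, if a ∘ π.1 = b then 1 else 0 := by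
  rw [productMoment_apply, ← Finset.prod_mul_distrib, DomMulAct.stabilizer_card,
    ← prod_sum_perm_fiber]
  simp only [kappa_mul_haarMoment_apply, Finset.prod_mul_distrib, Finset.prod_inv_distrib,
    Nat.cast_prod]

omit [DecidableEq ι] in
lemma integral_mul_tensorOp_comp (r : ι → κ) (i : κ) (g : Matrix (Fin d) (Fin d) ℂ → ℂ)
    (a b : ι → Fin d) :
    ∫ ψ, g (ψ i) * tensorOp (fun q => ψ (r q)) a b ∂Measure.pi (fun _ => haarState d) =
      (∫ ψ, g ψ * tensorOp (fun _ : {q // r q = i} => ψ) (a ∘ (↑)) (b ∘ (↑)) ∂haarState d) *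
        ∏ j ∈ Finset.univ.erase i, haarMoment d {q // r q = j} (a ∘ (↑)) (b ∘ (↑)) := by
  have hprod : ∀ ψ : κ → Matrix (Fin d) (Fin d) ℂ,
      g (ψ i) * tensorOp (fun q => ψ (r q)) a b =
        ∏ j, (if j = i then g (ψ j) else 1) *
          tensorOp (fun _ : {q // r q = j} => ψ j) (a ∘ (↑)) (b ∘ (↑)) := fun ψ => by
    rw [Finset.prod_mul_distrib, ← tensorOp_comp_apply, Finset.prod_ite_eq' Finset.univ i,
      if_pos (Finset.mem_univ i)]
  rw [integral_congr_ae (Filter.Eventually.of_forall hprod), integral_fintype_prod_eq_prod (𝕜 := ℂ)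
    (fun j ψ => (if j = i then g ψ else 1) *
      tensorOp (fun _ : {q // r q = j} => ψ) (a ∘ (↑)) (b ∘ (↑))),
    ← Finset.mul_prod_erase _ _ (Finset.mem_univ i)]
  simp only [if_true]
  refine congrArg _ (Finset.prod_congr rfl fun j hj => ?_)
  simp only [Finset.ne_of_mem_erase hj, if_false, one_mul, haarMoment_apply]

omit [DecidableEq ι] in
lemma productMoment_apply_of_eq_off_fiber (r : ι → κ) (i : κ) {a a' : ι → Fin d}
    (h : ∀ q, r q ≠ i → a' q = a q) (b : ι → Fin d) :
    productMoment d r a' b = haarMoment d {q // r q = i} (a' ∘ (↑)) (b ∘ (↑)) *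
      ∏ j ∈ Finset.univ.erase i, haarMoment d {q // r q = j} (a ∘ (↑)) (b ∘ (↑)) := by
  have hfiber : ∀ j ∈ Finset.univ.erase i,
      haarMoment d {q // r q = j} (a' ∘ (↑)) (b ∘ (↑)) =
        haarMoment d {q // r q = j} (a ∘ (↑)) (b ∘ (↑)) := by
    intro j hj
    have heq : a' ∘ ((↑) : {q // r q = j} → ι) = a ∘ (↑) :=
      funext fun q => h q (q.2.trans_ne (Finset.ne_of_mem_erase hj))
    rw [heq]
  rw [productMoment_apply, ← Finset.prod_congr rfl hfiber]
  exact (Finset.mul_prod_erase _ (fun j => haarMoment d {q // r q = j} (a' ∘ (↑)) (b ∘ (↑)))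
    (Finset.mem_univ i)).symm

lemma smul_matrixIntegral_smul_tensorOp_comp (r : ι → κ) (i : κ) (x y : Fin d) :
    ((d : ℂ) + Fintype.card {q // r q = i}) • matrixIntegral (Measure.pi fun _ => haarState d)
        (fun ψ => ψ i x y • tensorOp fun q => ψ (r q)) =
      ((1 : Matrix (Fin d) (Fin d) ℂ) x y • 1 +
        ∑ q : {q // r q = i}, localOp (q : ι) (Matrix.single y x 1)) * productMoment d r := by
  ext a b
  have hupdate : ∀ q : {q // r q = i}, productMoment d r (update a q x) b =
      haarMoment d {q // r q = i} (update (a ∘ (↑)) q x) (b ∘ (↑)) *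
        ∏ j ∈ Finset.univ.erase i, haarMoment d {q // r q = j} (a ∘ (↑)) (b ∘ (↑)) := fun q => by
    rw [← update_comp_eq_of_injective _ Subtype.val_injective]
    exact productMoment_apply_of_eq_off_fiber r i
      (fun s hs => update_of_ne (ne_of_apply_ne r (hs.trans_eq q.2.symm)) _ _) b
  have hfiber := congrFun₂ (smul_matrixIntegral_smul_tensorOp (ι := {q // r q = i}) x y)
    (a ∘ (↑)) (b ∘ (↑))
  simp only [Matrix.smul_apply, smul_eq_mul, matrixIntegral_apply, Matrix.add_mul, Matrix.smul_mul,
    Matrix.one_mul, Matrix.add_apply, collectiveOp_apply, Matrix.sum_mul, Matrix.sum_apply,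
    localOp_single_mul_apply, comp_apply] at hfiber ⊢
  rw [integral_mul_tensorOp_comp r i fun ψ => ψ x y, ← mul_assoc, hfiber,
    productMoment_apply_of_eq_off_fiber r i (fun _ _ => rfl) b, add_mul, Finset.sum_mul, mul_assoc]
  simp only [hupdate, ite_mul, zero_mul]

end ProductMoment

/-! ### The row symmetric measurement -/

section Measurement

variable {d n : ℕ}

lemma permOp_apply (π : Equiv.Perm (Fin n)) (a b : Fin n → Fin d) :
    permOp π a b = if a ∘ π = b then 1 else 0 :=
  if_congr (Equiv.eq_comp_symm π a b) rfl rfl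

lemma DPartition.mem_rowPerms_iff {lam : DPartition d n} {π : Equiv.Perm (Fin n)} :
    π ∈ lam.rowPerms ↔ lam.row ∘ π = lam.row := by
  simp only [rowPerms, Finset.mem_filter, Finset.mem_univ, true_and, funext_iff, comp_apply]

lemma DPartition.card_row (lam : DPartition d n) (i : Fin lam.length) :
    Fintype.card {q // lam.row q = i} = lam.part i := by
  rw [← Fintype.card_fin (lam.part i)]
  refine Fintype.card_congr (Equiv.ofBijective (fun s : Fin (lam.part i) =>
    (⟨lam.toComposition.embedding i s, lam.toComposition.index_embedding i s⟩ :
      {q // lam.row q = i})) ⟨fun s t h => ?_, ?_⟩).symm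
  · exact (lam.toComposition.embedding i).injective (congrArg Subtype.val h)
  · rintro ⟨q, rfl⟩
    exact ⟨lam.toComposition.invEmbedding q, Subtype.ext (lam.toComposition.embedding_comp_inv q)⟩

lemma DPartition.symProj_apply (lam : DPartition d n) (a b : Fin n → Fin d) :
    lam.symProj a b = (Fintype.card {π : Equiv.Perm (Fin n) // lam.row ∘ π = lam.row} : ℂ)⁻¹ *
      ∑ π : {π : Equiv.Perm (Fin n) // lam.row ∘ π = lam.row}, if a ∘ π.1 = b then 1 else 0 := by
  rw [symProj, Matrix.smul_apply, Matrix.sum_apply, smul_eq_mul,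
    Fintype.card_of_subtype lam.rowPerms fun _ => DPartition.mem_rowPerms_iff,
    Finset.sum_subtype (F := inferInstance) lam.rowPerms fun _ => DPartition.mem_rowPerms_iff]
  simp only [permOp_apply]

lemma rowPOVM_eq_smul_tensorOp (lam : DPartition d n)
    (ψ : Fin lam.length → Matrix (Fin d) (Fin d) ℂ) :
    rowPOVM lam ψ = (∏ i, (kappa d (lam.part i) : ℂ)) • tensorOp fun q => ψ (lam.row q) := rfl

@[fun_prop]
lemma continuous_rowPOVM (lam : DPartition d n) : Continuous (rowPOVM lam) := by
  unfold rowPOVM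
  fun_prop

variable [NeZero d]

lemma prod_kappa_smul_productMoment_row (lam : DPartition d n) :
    (∏ i, (kappa d (lam.part i) : ℂ)) • productMoment d lam.row = lam.symProj := by
  ext a b
  rw [lam.symProj_apply, ← prod_kappa_smul_productMoment_apply]
  simp only [Matrix.smul_apply, smul_eq_mul, lam.card_row]

lemma matrixIntegral_rowPOVM (lam : DPartition d n) :
    matrixIntegral (Measure.pi fun _ => haarState d) (rowPOVM lam) = lam.symProj := by
  rw [← prod_kappa_smul_productMoment_row]
  ext a b
  exact integral_const_mul _ _

lemma smul_matrixIntegral_smul_rowPOVM (lam : DPartition d n) (i : Fin lam.length) (x y : Fin d) :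
    ((d : ℂ) + lam.part i) • matrixIntegral (Measure.pi fun _ => haarState d)
        (fun ψ => ψ i x y • rowPOVM lam ψ) =
      ((1 : Matrix (Fin d) (Fin d) ℂ) x y • 1 +
        ∑ q : {q // lam.row q = i}, localOp (q : Fin n) (Matrix.single y x 1)) * lam.symProj := by
  have hscalar : matrixIntegral (Measure.pi fun _ => haarState d)
        (fun ψ => ψ i x y • rowPOVM lam ψ) =
      (∏ i, (kappa d (lam.part i) : ℂ)) • matrixIntegral (Measure.pi fun _ => haarState d)
        (fun ψ => ψ i x y • tensorOp fun q => ψ (lam.row q)) := by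
    ext a b
    rw [Matrix.smul_apply, matrixIntegral_apply, matrixIntegral_apply, smul_eq_mul,
      ← integral_const_mul]
    exact integral_congr_ae (Filter.Eventually.of_forall fun ψ => mul_left_comm _ _ _)
  rw [hscalar, smul_comm, ← prod_kappa_smul_productMoment_row, Matrix.mul_smul,
    ← smul_matrixIntegral_smul_tensorOp_comp, lam.card_row]

lemma matrixIntegral_shadow_smul_rowPOVM (lam : DPartition d n) (x y : Fin d) :
    matrixIntegral (Measure.pi fun _ => haarState d)
        (fun ψ => shadow lam (Sum.inl ψ) x y • rowPOVM lam ψ) =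
      ((lam.length * (1 : Matrix (Fin d) (Fin d) ℂ) x y) • 1 +
        collectiveOp (Fin n) (Matrix.single y x 1)) * lam.symProj := by
  have hsum : matrixIntegral (Measure.pi fun _ => haarState d)
        (fun ψ => shadow lam (Sum.inl ψ) x y • rowPOVM lam ψ) =
      ∑ i, ((d : ℂ) + lam.part i) • matrixIntegral (Measure.pi fun _ => haarState d)
        (fun ψ => ψ i x y • rowPOVM lam ψ) := by
    ext a b
    simp only [shadow, matrixIntegral_apply, Matrix.sum_apply, Matrix.smul_apply, smul_eq_mul,
      Finset.sum_mul, mul_assoc]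
    rw [integral_finsetSum _ fun i _ => integrable_pi_haarState (by fun_prop)]
    simp only [integral_const_mul]
  simp only [hsum, smul_matrixIntegral_smul_rowPOVM]
  rw [← Finset.sum_mul, Finset.sum_add_distrib, Finset.sum_const, Finset.card_univ,
    Fintype.card_fin, ← Nat.cast_smul_eq_nsmul ℂ, smul_smul,
    Fintype.sum_fiberwise lam.row fun q => localOp q (Matrix.single y x 1), collectiveOp_apply]

lemma posSemidef_rowPOVM {lam : DPartition d n} {ψ : Fin lam.length → Matrix (Fin d) (Fin d) ℂ}
    (hψ : ∀ i, ψ i ∈ Set.range pureState) : (rowPOVM lam ψ).PosSemidef := by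
  choose V hV using hψ
  obtain rfl : (fun i => pureState (V i)) = ψ := funext hV
  have hnonneg : (0 : ℂ) ≤ ∏ i, (kappa d (lam.part i) : ℂ) :=
    Finset.prod_nonneg fun _ _ => Nat.cast_nonneg _
  have hfactor : tensorOp (fun q => pureState (V (lam.row q))) =
      tensorOp (fun q => (V (lam.row q)).1 * Matrix.single 0 0 1) *
        (tensorOp fun q => (V (lam.row q)).1 * Matrix.single 0 0 1)ᴴ := by
    simp only [conjTranspose_tensorOp, tensorOp_mul_tensorOp, pureState_eq_mul_conjTranspose]
    rfl
  rw [rowPOVM_eq_smul_tensorOp, hfactor]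
  exact (Matrix.posSemidef_self_mul_conjTranspose _).smul hnonneg

end Measurement

/-! ### The law of the outcome -/

section OutcomeLaw

variable {d n : ℕ}

lemma trace_mul_stateMatrix (M : QuditOp d n) (φ : Qudits d n) :
    (M * stateMatrix φ).trace = star (fun a => φ a) ⬝ᵥ M *ᵥ fun a => φ a := by
  rw [stateMatrix, Matrix.mul_vecMulVec, Matrix.trace_vecMulVec, dotProduct_comm]
  rfl

lemma trace_mul_stateMatrix_nonneg {M : QuditOp d n} (hM : M.PosSemidef) (φ : Qudits d n) :
    0 ≤ (M * stateMatrix φ).trace := by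
  rw [trace_mul_stateMatrix]
  exact hM.dotProduct_mulVec_nonneg _

lemma trace_stateMatrix (φ : Qudits d n) : (stateMatrix φ).trace = (‖φ‖ : ℂ) ^ 2 := by
  have h := inner_self_eq_norm_sq_to_K (𝕜 := ℂ) φ
  rw [EuclideanSpace.inner_eq_star_dotProduct] at h
  rw [stateMatrix, Matrix.trace_vecMulVec]
  exact h

lemma mul_stateMatrix_of_act_eq {M : QuditOp d n} {φ : Qudits d n} (h : act M φ = φ) :
    M * stateMatrix φ = stateMatrix φ := by
  rw [stateMatrix, Matrix.mul_vecMulVec]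
  exact congrArg (Matrix.vecMulVec · _) (funext fun a => congrArg (fun x : Qudits d n => x a) h)

lemma measurableEmbedding_sumInl {α β : Type*} [MeasurableSpace α] [MeasurableSpace β] :
    MeasurableEmbedding (Sum.inl : α → α ⊕ β) :=
  ⟨Sum.inl_injective, measurable_inl, fun _ => MeasurableSet.inl_image⟩

/-- The Born rule density `tr(F^{(λ)}(ψ) |φ⟩⟨φ|)` of the row symmetric measurement with respect to
`μ_H^k`, as a complex number; it is real and nonnegative at density matrices of pure states. -/
def bornDensity (lam : DPartition d n) (φ : Qudits d n)
    (ψ : Fin lam.length → Matrix (Fin d) (Fin d) ℂ) : ℂ :=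
  (rowPOVM lam ψ * stateMatrix φ).trace

@[fun_prop]
lemma continuous_bornDensity (lam : DPartition d n) (φ : Qudits d n) :
    Continuous (bornDensity lam φ) := by
  unfold bornDensity
  fun_prop

lemma measurable_ofReal_re_bornDensity (lam : DPartition d n) (φ : Qudits d n) :
    Measurable fun ψ => ENNReal.ofReal (bornDensity lam φ ψ).re :=
  (Complex.continuous_re.comp (continuous_bornDensity lam φ)).measurable.ennreal_ofReal

variable [NeZero d]

lemma ae_bornDensity_nonneg (lam : DPartition d n) (φ : Qudits d n) :
    ∀ᵐ ψ ∂Measure.pi fun _ => haarState d, 0 ≤ bornDensity lam φ ψ :=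
  ae_pi_mem_range_pureState.mono fun _ hψ =>
    trace_mul_stateMatrix_nonneg (posSemidef_rowPOVM hψ) φ

lemma integral_mul_bornDensity (lam : DPartition d n) (φ : Qudits d n)
    {g : (Fin lam.length → Matrix (Fin d) (Fin d) ℂ) → ℂ} (hg : Continuous g) :
    ∫ ψ, g ψ * bornDensity lam φ ψ ∂Measure.pi (fun _ => haarState d) =
      (matrixIntegral (Measure.pi fun _ => haarState d) (fun ψ => g ψ • rowPOVM lam ψ) *
        stateMatrix φ).trace := by
  rw [matrixIntegral_mul _ fun a b => integrable_pi_haarState (by fun_prop),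
    trace_matrixIntegral fun a => integrable_pi_haarState (by fun_prop)]
  simp only [Matrix.smul_mul, Matrix.trace_smul, smul_eq_mul, bornDensity]

lemma lintegral_bornDensity {lam : DPartition d n} {φ : Qudits d n}
    (hsym : act lam.symProj φ = φ) (hnorm : ‖φ‖ = 1) :
    ∫⁻ ψ, ENNReal.ofReal (bornDensity lam φ ψ).re ∂(Measure.pi fun _ => haarState d) = 1 := by
  have hcomplex : ∫ ψ, bornDensity lam φ ψ ∂(Measure.pi fun _ => haarState d) = 1 := by
    have h := integral_mul_bornDensity lam φ (continuous_const (y := 1))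
    simp only [one_mul, one_smul] at h
    rw [h, matrixIntegral_rowPOVM, mul_stateMatrix_of_act_eq hsym, trace_stateMatrix, hnorm]
    simp
  have hint : Integrable (bornDensity lam φ) (Measure.pi fun _ => haarState d) :=
    integrable_pi_haarState (continuous_bornDensity lam φ)
  have hreal : ∫ ψ, (bornDensity lam φ ψ).re ∂(Measure.pi fun _ => haarState d) = 1 :=
    (integral_re hint).trans (by rw [hcomplex, RCLike.one_re])
  refine (ofReal_integral_eq_lintegral_ofReal hint.re ((ae_bornDensity_nonneg lam φ).mono
    fun ψ hψ => (Complex.nonneg_iff.mp hψ).1)).symm.trans ?_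
  exact (congrArg ENNReal.ofReal hreal).trans ENNReal.ofReal_one

lemma outcomeLaw_eq_map {lam : DPartition d n} {φ : Qudits d n} (hsym : act lam.symProj φ = φ) :
    outcomeLaw lam φ = ((Measure.pi fun _ => haarState d).withDensity fun ψ =>
      ENNReal.ofReal (bornDensity lam φ ψ).re).map Sum.inl := by
  rw [outcomeLaw, sub_mul, one_mul, mul_stateMatrix_of_act_eq hsym, sub_self, Matrix.trace_zero,
    Complex.zero_re, ENNReal.ofReal_zero, zero_smul, add_zero]
  rfl

lemma isProbabilityMeasure_outcomeLaw {lam : DPartition d n} {φ : Qudits d n}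
    (hsym : act lam.symProj φ = φ) (hnorm : ‖φ‖ = 1) :
    IsProbabilityMeasure (outcomeLaw lam φ) := by
  constructor
  rw [outcomeLaw_eq_map hsym, measurableEmbedding_sumInl.map_apply, Set.preimage_univ,
    withDensity_apply _ MeasurableSet.univ, setLIntegral_univ, lintegral_bornDensity hsym hnorm]

lemma outcomeLaw_fail {lam : DPartition d n} {φ : Qudits d n} (hsym : act lam.symProj φ = φ) :
    outcomeLaw lam φ {Sum.inr ()} = 0 := by
  have hpreimage : (Sum.inl ⁻¹' {Sum.inr ()} :
      Set (Fin lam.length → Matrix (Fin d) (Fin d) ℂ)) = ∅ := by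
    ext
    simp
  rw [outcomeLaw_eq_map hsym, measurableEmbedding_sumInl.map_apply, hpreimage, measure_empty]

lemma ae_smul_shadow (lam : DPartition d n) (φ : Qudits d n) (x y : Fin d) :
    (fun ψ => (ENNReal.ofReal (bornDensity lam φ ψ).re).toReal • shadow lam (Sum.inl ψ) x y)
      =ᵐ[Measure.pi fun _ => haarState d]
        fun ψ => shadow lam (Sum.inl ψ) x y * bornDensity lam φ ψ := by
  filter_upwards [ae_bornDensity_nonneg lam φ] with ψ hψ
  rw [ENNReal.toReal_ofReal (Complex.nonneg_iff.mp hψ).1, Complex.real_smul, mul_comm,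
    ← Complex.eq_re_of_ofReal_le hψ]

omit [NeZero d] in
lemma continuous_shadow_inl (lam : DPartition d n) (x y : Fin d) :
    Continuous fun ψ => shadow lam (Sum.inl ψ) x y := by
  simp only [shadow, Matrix.sum_apply, Matrix.smul_apply]
  fun_prop

lemma integrable_shadow {lam : DPartition d n} {φ : Qudits d n} (hsym : act lam.symProj φ = φ)
    (x y : Fin d) : Integrable (fun o => shadow lam o x y) (outcomeLaw lam φ) := by
  rw [outcomeLaw_eq_map hsym, measurableEmbedding_sumInl.integrable_map_iff, comp_def,
    integrable_withDensity_iff_integrable_smul' (measurable_ofReal_re_bornDensity lam φ)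
      (Filter.Eventually.of_forall fun _ => ENNReal.ofReal_lt_top),
    integrable_congr (ae_smul_shadow lam φ x y)]
  exact integrable_pi_haarState ((continuous_shadow_inl lam x y).mul (continuous_bornDensity lam φ))

lemma matrixIntegral_shadow {lam : DPartition d n} {φ : Qudits d n}
    (hsym : act lam.symProj φ = φ) (hnorm : ‖φ‖ = 1) :
    matrixIntegral (outcomeLaw lam φ) (shadow lam) =
      (lam.length : ℂ) • 1 + oneBodyMatrix (stateMatrix φ) := by
  ext x y
  rw [matrixIntegral_apply, outcomeLaw_eq_map hsym, measurableEmbedding_sumInl.integral_map,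
    integral_withDensity_eq_integral_toReal_smul (measurable_ofReal_re_bornDensity lam φ)
      (Filter.Eventually.of_forall fun _ => ENNReal.ofReal_lt_top),
    integral_congr_ae (ae_smul_shadow lam φ x y),
    integral_mul_bornDensity lam φ (continuous_shadow_inl lam x y),
    matrixIntegral_shadow_smul_rowPOVM, Matrix.mul_assoc, mul_stateMatrix_of_act_eq hsym,
    Matrix.add_mul, Matrix.smul_mul, Matrix.one_mul, Matrix.trace_add, Matrix.trace_smul,
    trace_stateMatrix, hnorm]
  simp [oneBodyMatrix]

end OutcomeLaw

/-! ### Weight vectors and the one-body matrix -/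

section Weights

variable {d n : ℕ}

lemma stateMatrix_act (T : QuditOp d n) (φ : Qudits d n) :
    stateMatrix (act T φ) = T * stateMatrix φ * Tᴴ := by
  rw [stateMatrix, stateMatrix, Matrix.mul_vecMulVec, Matrix.vecMulVec_mul]
  exact congrArg (Matrix.vecMulVec _) (Matrix.star_mulVec T fun a => φ a)

lemma tensorPow_eq_tensorOp (M : Matrix (Fin d) (Fin d) ℂ) :
    tensorPow n M = tensorOp fun _ => M := rfl

lemma norm_act_tensorPow (U : Matrix.unitaryGroup (Fin d) ℂ) (φ : Qudits d n) :
    ‖act (tensorPow n U.1) φ‖ = ‖φ‖ := by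
  have htrace := trace_stateMatrix (act (tensorPow n U.1) φ)
  rw [stateMatrix_act, Matrix.trace_mul_comm, ← Matrix.mul_assoc, tensorPow_eq_tensorOp,
    conjTranspose_tensorOp, tensorOp_mul_tensorOp_eq_one (V := U.1ᴴ) (Unitary.coe_star_mul_self U),
    Matrix.one_mul, trace_stateMatrix] at htrace
  exact (sq_eq_sq₀ (norm_nonneg _) (norm_nonneg _)).mp (by exact_mod_cast htrace.symm)

lemma oneBodyMatrix_stateMatrix_act_tensorPow (U : Matrix.unitaryGroup (Fin d) ℂ)
    (φ : Qudits d n) :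
    oneBodyMatrix (stateMatrix (act (tensorPow n U.1) φ)) =
      U.1 * oneBodyMatrix (stateMatrix φ) * U.1ᴴ := by
  rw [stateMatrix_act, tensorPow_eq_tensorOp, conjTranspose_tensorOp,
    oneBodyMatrix_tensorOp_mul_mul_tensorOp (V := U.1ᴴ) (Unitary.coe_star_mul_self U)]

lemma apply_eq_zero_of_mem_weightSpace {w : Fin d → ℕ} {τ : Qudits d n}
    (hτ : τ ∈ weightSpace n w) {a : Fin n → Fin d} (ha : weight a ≠ w) : τ a = 0 := by
  induction hτ using Submodule.span_induction with
  | mem x hx =>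
    obtain ⟨b, hb, rfl⟩ := hx
    have hab : a ≠ b := by
      rintro rfl
      exact ha hb
    simp [ket, hab]
  | zero => rfl
  | add x y _ _ hx hy => simp [hx, hy]
  | smul c x _ hx => simp [hx]

lemma weight_update_ne (a : Fin n → Fin d) {q : Fin n} {x : Fin d} (hx : x ≠ a q) :
    weight (update a q x) ≠ weight a := by
  have hsubset : (Finset.univ.filter fun r => a r = x) ⊂
      Finset.univ.filter fun r => update a q x r = x := by
    refine (Finset.ssubset_iff_of_subset fun r hr => ?_).mpr ⟨q, by simp, by simpa using hx.symm⟩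
    rcases eq_or_ne r q with rfl | hrq
    · simp
    · simpa [hrq] using hr
  exact fun h => (Finset.card_lt_card hsubset).ne' (congrFun h x)

lemma oneBodyMatrix_stateMatrix_of_mem_weightSpace {w : Fin d → ℕ} {τ : Qudits d n}
    (hτ : τ ∈ weightSpace n w) :
    oneBodyMatrix (stateMatrix τ) = (‖τ‖ : ℂ) ^ 2 • Matrix.diagonal fun i => (w i : ℂ) := by
  ext x y
  rw [oneBodyMatrix_apply_eq_sum, Finset.sum_comm, Matrix.smul_apply, smul_eq_mul,
    ← trace_stateMatrix, Matrix.trace, Finset.sum_mul]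
  refine Finset.sum_congr rfl fun a _ => ?_
  simp only [Matrix.diag_apply, stateMatrix, Matrix.vecMulVec_apply]
  by_cases ha : weight a = w
  · rcases eq_or_ne x y with rfl | hxy
    · have hupdate : ∀ q, (if a q = x then τ (update a q x) * star (τ a) else 0) =
          if a q = x then τ a * star (τ a) else 0 := by
        intro q
        split_ifs with hq
        · rw [← hq, update_eq_self]
        · rfl
      rw [Fintype.sum_congr _ _ hupdate, ← Finset.sum_filter, Finset.sum_const, nsmul_eq_mul,
        Matrix.diagonal_apply_eq, ← ha, mul_comm]
      rfl
    · rw [Matrix.diagonal_apply_ne _ hxy, mul_zero]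
      refine Finset.sum_eq_zero fun q _ => ite_eq_right_iff.mpr fun hq => ?_
      rw [apply_eq_zero_of_mem_weightSpace hτ
        fun h => weight_update_ne a (hxy.trans_eq hq.symm) (h.trans ha.symm), zero_mul]
  · simp [apply_eq_zero_of_mem_weightSpace hτ ha]

end Weights

/-! ### The output of the pre-processing -/

section Preprocessing

variable {d n : ℕ} {lam : DPartition d n}

lemma act_mul (M N : QuditOp d n) (x : Qudits d n) : act (M * N) x = act M (act N x) :=
  congrArg (WithLp.toLp 2) (Matrix.mulVec_mulVec _ M N).symm

lemma permOp_mul_permOp (π σ : Equiv.Perm (Fin n)) :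
    (permOp π * permOp σ : QuditOp d n) = permOp (π * σ) := by
  ext a b
  simp only [Matrix.mul_apply, permOp_apply, ite_mul, one_mul, zero_mul, Finset.sum_ite_eq,
    Finset.mem_univ, if_true]
  rfl

lemma DPartition.mul_mem_rowPerms {π σ : Equiv.Perm (Fin n)} (hπ : π ∈ lam.rowPerms) :
    π * σ ∈ lam.rowPerms ↔ σ ∈ lam.rowPerms := by
  rw [mem_rowPerms_iff] at hπ ⊢
  rw [mem_rowPerms_iff, Equiv.Perm.coe_mul, ← comp_assoc, hπ]

lemma permOp_mul_youngSymmetrizer {π : Equiv.Perm (Fin n)} (hπ : π ∈ lam.rowPerms) :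
    permOp π * lam.youngSymmetrizer = lam.youngSymmetrizer := by
  rw [DPartition.youngSymmetrizer, ← mul_assoc]
  congr 1
  rw [Finset.mul_sum]
  exact Finset.sum_equiv (Equiv.mulLeft π) (fun _ => (DPartition.mul_mem_rowPerms hπ).symm)
    fun σ _ => permOp_mul_permOp π σ

lemma symProj_mul_youngSymmetrizer (lam : DPartition d n) :
    lam.symProj * lam.youngSymmetrizer = lam.youngSymmetrizer := by
  have hcard : (lam.rowPerms.card : ℂ) ≠ 0 :=
    Nat.cast_ne_zero.mpr (Finset.card_ne_zero_of_mem (a := 1)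
      (DPartition.mem_rowPerms_iff.mpr rfl))
  rw [DPartition.symProj, Matrix.smul_mul, Finset.sum_mul,
    Finset.sum_congr rfl fun _ hπ => permOp_mul_youngSymmetrizer hπ, Finset.sum_const,
    ← Nat.cast_smul_eq_nsmul ℂ, inv_smul_smul₀ hcard]

lemma act_symProj_of_mem_canonicalIrrep {φ : Qudits d n} (hφ : φ ∈ lam.canonicalIrrep) :
    act lam.symProj φ = φ := by
  obtain ⟨x, rfl⟩ := hφ
  rw [← act_mul, symProj_mul_youngSymmetrizer]

variable {v : SchurFamily d n}

lemma IsNiceSchurBasis.mem_canonicalIrrep (hv : IsNiceSchurBasis v) {i : ℕ} (hi : i < lam.dimQ) :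
    v lam i 0 ∈ lam.canonicalIrrep := by
  obtain ⟨⟨wt, -, hwt⟩, -⟩ := hv lam
  refine LinearMap.map_le_range (p := weightSpace n (wt i)) ?_
  rw [← (hwt (wt i)).2]
  exact Submodule.subset_span ⟨i, hi, rfl, rfl⟩

variable {j : ℕ} {H : Qudits d n →ₗ[ℂ] Qudits d n} {y : Qudits d n}

lemma IsBasisSwap.apply_apply (hH : IsBasisSwap v lam j H) (hy : y ∈ schurBlock v lam j) :
    H (H y) = y := by
  have heq : Set.EqOn (H ∘ₗ H) (LinearMap.id : Qudits d n →ₗ[ℂ] Qudits d n)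
      {x | ∃ i < lam.dimQ, x = v lam i j} := by
    rintro _ ⟨i, hi, rfl⟩
    simp only [LinearMap.comp_apply, hH.map_self i hi, hH.map_zero i hi, LinearMap.id_apply]
  exact LinearMap.eqOn_span heq hy

lemma IsBasisSwap.apply_mem_canonicalIrrep (hH : IsBasisSwap v lam j H) (hv : IsNiceSchurBasis v)
    (hy : y ∈ schurBlock v lam j) : H y ∈ lam.canonicalIrrep := by
  have hle : schurBlock v lam j ≤ lam.canonicalIrrep.comap H := by
    refine Submodule.span_le.mpr ?_
    rintro _ ⟨i, hi, rfl⟩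
    rw [SetLike.mem_coe, Submodule.mem_comap, hH.map_self i hi]
    exact hv.mem_canonicalIrrep hi
  exact hle hy

lemma IsPreprocessingOutput.mem_canonicalIrrep_and_norm_eq_one {input out : Qudits d n}
    (hout : IsPreprocessingOutput v input lam out) (hv : IsNiceSchurBasis v) :
    out ∈ lam.canonicalIrrep ∧ ‖out‖ = 1 := by
  obtain ⟨j, -, H, hH, hne, rfl⟩ := hout
  have hmem := Submodule.starProjection_apply_mem (schurBlock v lam j) input
  have hHne : H ((schurBlock v lam j).starProjection input) ≠ 0 := fun h0 =>
    hne (by rw [← hH.apply_apply hmem, h0, map_zero])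
  refine ⟨Submodule.smul_mem _ _ (hH.apply_mem_canonicalIrrep hv hmem), ?_⟩
  rw [norm_smul, Complex.norm_real, norm_inv, norm_norm,
    inv_mul_cancel₀ (norm_ne_zero_iff.mpr hHne)]

end Preprocessing

end RowSym

end

theorem mainTheorem5_general {d n : ℕ} [NeZero d] (U : Matrix.unitaryGroup (Fin d) ℂ)
    (lam : DPartition d n) (τ : Qudits d n)
    (hsym : act lam.symProj (act (tensorPow n (U : Matrix (Fin d) (Fin d) ℂ)) τ) =
      act (tensorPow n (U : Matrix (Fin d) (Fin d) ℂ)) τ)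
    (hnorm : ‖τ‖ = 1) (w : Fin d → ℕ) (hτ : τ ∈ weightSpace n w) :
    MeasureTheory.IsProbabilityMeasure (outcomeLaw lam
      (act (tensorPow n (U : Matrix (Fin d) (Fin d) ℂ)) τ)) ∧
    outcomeLaw lam (act (tensorPow n (U : Matrix (Fin d) (Fin d) ℂ)) τ) {Sum.inr ()} = 0 ∧
    (∀ a b : Fin d, MeasureTheory.Integrable (fun o => shadow lam o a b)
      (outcomeLaw lam (act (tensorPow n (U : Matrix (Fin d) (Fin d) ℂ)) τ))) ∧
    (Matrix.of fun a b : Fin d => ∫ o, shadow lam o a b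
        ∂(outcomeLaw lam (act (tensorPow n (U : Matrix (Fin d) (Fin d) ℂ)) τ))) =
      (lam.length : ℂ) • (1 : Matrix (Fin d) (Fin d) ℂ) +
        ∑ i : Fin d, (w i : ℂ) •
          ((U : Matrix (Fin d) (Fin d) ℂ) * Matrix.single i i 1 *
            (U : Matrix (Fin d) (Fin d) ℂ).conjTranspose) := by
  have hnorm' := (norm_act_tensorPow U τ).trans hnorm
  refine ⟨isProbabilityMeasure_outcomeLaw hsym hnorm', outcomeLaw_fail hsym,
    integrable_shadow hsym, (matrixIntegral_shadow hsym hnorm').trans ?_⟩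
  rw [oneBodyMatrix_stateMatrix_act_tensorPow, oneBodyMatrix_stateMatrix_of_mem_weightSpace hτ,
    hnorm, Complex.ofReal_one, one_pow, one_smul, mul_diagonal_mul_eq_sum_smul]

theorem mainTheorem5 {d n : ℕ} [NeZero d]
    (v : SchurFamily d n) (hv : IsNiceSchurBasis v)
    (U : Matrix.unitaryGroup (Fin d) ℂ) (e : Fin n → Fin d)
    (lam : DPartition d n) (τ : Qudits d n)
    (hout : IsPreprocessingOutput v
      (act (tensorPow n (U : Matrix (Fin d) (Fin d) ℂ)) (ket e)) lam
      (act (tensorPow n (U : Matrix (Fin d) (Fin d) ℂ)) τ))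
    (w : Fin d → ℕ) (hτ : τ ∈ weightSpace n w) :
    MeasureTheory.IsProbabilityMeasure (outcomeLaw lam
      (act (tensorPow n (U : Matrix (Fin d) (Fin d) ℂ)) τ)) ∧
    outcomeLaw lam (act (tensorPow n (U : Matrix (Fin d) (Fin d) ℂ)) τ) {Sum.inr ()} = 0 ∧
    (∀ a b : Fin d, MeasureTheory.Integrable (fun o => shadow lam o a b)
      (outcomeLaw lam (act (tensorPow n (U : Matrix (Fin d) (Fin d) ℂ)) τ))) ∧
    (Matrix.of fun a b : Fin d => ∫ o, shadow lam o a b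
        ∂(outcomeLaw lam (act (tensorPow n (U : Matrix (Fin d) (Fin d) ℂ)) τ))) =
      (lam.length : ℂ) • (1 : Matrix (Fin d) (Fin d) ℂ) +
        ∑ i : Fin d, (w i : ℂ) •
          ((U : Matrix (Fin d) (Fin d) ℂ) * Matrix.single i i 1 *
            (U : Matrix (Fin d) (Fin d) ℂ).conjTranspose) := by
  obtain ⟨hmem, hnorm⟩ := hout.mem_canonicalIrrep_and_norm_eq_one hv
  exact mainTheorem5_general U lam τ (act_symProj_of_mem_canonicalIrrep hmem)
    ((norm_act_tensorPow U τ).symm.trans hnorm) w hτ
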